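/- **Theorem.** Let $n\in\mathbb N$ and $\lambda\in\mathbb R\setminus\{0\}$. Write points of $\mathbb R^{2n}$ as $\xi=(x,u)$ with $x,u\in\mathbb R^n$, put $[(x,u),(y,v)]=u\cdot y-v\cdot x$, and extend this form and the dot product complex-bilinearly to $\mathbb C^{2n}$. For a Schwartz function $g\in\mathcal S(\mathbb R^{2n})$ define the twisted translations, the twisted modulations and the operators $\Pi_\lambda$, $U_\lambda$ by $$\tau_\lambda(\eta)g(\xi)=g(\xi-\eta)\,e^{-i\frac{\lambda}{2}[\xi,\eta]},$$ $$e_\lambda(a,b)g(x,u)=g\big(x-(\tanh\tfrac{\lambda}{2})\,b,\;u+(\tanh\tfrac{\lambda}{2})\,a\big)\,e^{-i\frac{\lambda}{2}(\coth\frac{\lambda}{2})(x\cdot a+u\cdot b)},$$ $$\Pi_\lambda(\xi,\eta)=e^{i\frac{\lambda}{2}(\coth\lambda)\,\xi\cdot\eta}\,e_\lambda(\eta)\,\tau_\lambda(\xi),\qquad U_\lambda g(\xi)=c(\lambda)^n\,\widehat g(c(\lambda)\xi),\quad c(\lambda)=\tfrac{\lambda}{2}\coth\tfrac{\lambda}{2},$$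 where $\widehat g(\omega)=(2\pi)^{-n}\int_{\mathbb R^{2n}}e^{-iy\cdot\omega}g(y)\,dy$. Let $\langle f,g\rangle$ be the sesquilinear pairing of a tempered distribution $f$ with a Schwartz function $g$ that extends $\int f\bar g$. The operators are extended to tempered distributions by duality, $\langle Tf,g\rangle=\langle f,T^*g\rangle$, where $\tau_\lambda(\xi)^*=\tau_\lambda(-\xi)$, $e_\lambda(\eta)^*=e_\lambda(-\eta)$ and $U_\lambda^*g(\xi)=c(\lambda)^n(2\pi)^{-n}\int e^{i c(\lambda)y\cdot\xi}g(y)\,dy$. For $1\le p,q\le\infty$ let $M_\lambda^{p,q}(\mathbb R^{2n})$ be the set of tempered distributions $f$ on $\mathbb R^{2n}$ for which there is a non-zero $g\in\mathcal S(\mathbb R^{2n})$ such that $(\xi,\eta)\mapsto\langle f,\Pi_\lambda(\xi,\eta)g\rangle$ belongs to the mixed norm space $L^{p,q}(\mathbb R^{2n}\times\mathbb R^{2n})$ ($L^p$ norm in $\xi$ first, then $L^q$ norm in $\eta$). Then: 1. The operators are those transported from the twisted Fock space by the twisted Bargmann transform. Let $p_t^\lambda(\zeta)=(4\pi)^{-n}\lambda^n(\sinh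 t\lambda)^{-n}e^{-\frac{\lambda}{4}(\coth t\lambda)\,\zeta\cdot\zeta}$ and $c_\lambda=(4\pi)^{-n}\lambda^n(\sinh\lambda)^{-n}$, and for $\zeta\in\mathbb C^{2n}$ let $$B_\lambda g(\zeta)=c_\lambda\,p_1^\lambda(\zeta)^{-1}\int_{\mathbb R^{2n}}g(\eta)\,p_{1/2}^\lambda(\zeta-\eta)\,e^{-i\frac{\lambda}{2}[\zeta,\eta]}\,d\eta,$$ $$\rho_\lambda(\zeta')F(\zeta)=F(\zeta-\zeta')\,e^{\frac{\lambda}{2}(\coth\lambda)\,\zeta\cdot\overline{\zeta'}}\,e^{-i\frac{\lambda}{2}[\zeta,\overline{\zeta'}]}\,e^{-\frac{\lambda}{4}(\coth\lambda)|\zeta'|^2}\,e^{\frac{\lambda}{2}[\Re\zeta',\Im\zeta']}.$$ For all $\xi,\eta\in\mathbb R^{2n}$, $\zeta\in\mathbb C^{2n}$ and $g\in\mathcal S(\mathbb R^{2n})$ one has $B_\lambda(\Pi_\lambda(\xi,\eta)g)=\rho_\lambda(\xi+i\eta)(B_\lambda g)$ and $B_\lambda(U_\lambda g)(\zeta)=B_\lambda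 g(-i\zeta)$. 2. For all $1\le p,q\le\infty$, $M_\lambda^{p,q}(\mathbb R^{2n})$ is invariant under $\tau_\lambda(\xi)$ and under $e_\lambda(\eta)$ for all $\xi,\eta\in\mathbb R^{2n}$. 3. $U_\lambda\,\Pi_\lambda(\xi,\eta)\,U_\lambda^*=\Pi_\lambda(-\eta,\xi)$ on tempered distributions (in particular on $L^2(\mathbb R^{2n})$) for all $\xi,\eta\in\mathbb R^{2n}$. 4. For all $1\le p\le\infty$, $M_\lambda^{p,p}(\mathbb R^{2n})$ is invariant under $U_\lambda$. -/

import Mathlib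

open MeasureTheory
open scoped SchwartzMap FourierTransform ENNReal ComplexConjugate

noncomputable section

namespace TwistedMod

/-! ### The spaces `ℝ²ⁿ` and `ℂ²ⁿ`

A point of `ℝ²ⁿ = ℝⁿ × ℝⁿ` is written `ξ = (x, u)`; `x` has the indices `Sum.inl i` and `u` the
indices `Sum.inr i`. -/

/-- `ℝ²ⁿ` with its Euclidean structure. -/
abbrev RR (n : ℕ) := EuclideanSpace ℝ (Fin n ⊕ Fin n)

/-- `ℂ²ⁿ`. -/
abbrev CC (n : ℕ) := EuclideanSpace ℂ (Fin n ⊕ Fin n)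

/-- The symplectic form `[(x,u),(y,v)] = u·y - v·x` on `ℝ²ⁿ`. -/
def symp {n : ℕ} (ξ η : RR n) : ℝ :=
  ∑ i : Fin n, (ξ (Sum.inr i) * η (Sum.inl i) - η (Sum.inr i) * ξ (Sum.inl i))

/-- The complex bilinear extension of the symplectic form to `ℂ²ⁿ`. -/
def csymp {n : ℕ} (ζ ζ' : CC n) : ℂ :=
  ∑ i : Fin n, (ζ (Sum.inr i) * ζ' (Sum.inl i) - ζ' (Sum.inr i) * ζ (Sum.inl i))

/-- The complex bilinear dot product `ζ·ζ'` on `ℂ²ⁿ` (no conjugation). -/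
def cdot {n : ℕ} (ζ ζ' : CC n) : ℂ := ∑ j, ζ j * ζ' j

/-- The matrix `J = (0, I; -I, 0)`: `J (a,b) = (b,-a)`. -/
def rotJ {n : ℕ} (ξ : RR n) : RR n :=
  WithLp.toLp 2 (Sum.elim (fun i => ξ (Sum.inr i)) (fun i => -ξ (Sum.inl i)))

/-- The inclusion `ℝ²ⁿ ⊆ ℂ²ⁿ`. -/
def toCC {n : ℕ} (ξ : RR n) : CC n := WithLp.toLp 2 (fun j => (ξ j : ℂ))

/-- The coordinatewise conjugate of `ζ`. -/
def conjCC {n : ℕ} (ζ : CC n) : CC n := WithLp.toLp 2 (fun j => conj (ζ j))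

/-- The coordinatewise real part of `ζ`. -/
def reCC {n : ℕ} (ζ : CC n) : RR n := WithLp.toLp 2 (fun j => (ζ j).re)

/-- The coordinatewise imaginary part of `ζ`. -/
def imCC {n : ℕ} (ζ : CC n) : RR n := WithLp.toLp 2 (fun j => (ζ j).im)

/-- The hyperbolic cotangent (used only at non-zero arguments). -/
def coth (s : ℝ) : ℝ := Real.cosh s / Real.sinh s

/-- `c(λ) = (λ/2) coth(λ/2)`. -/
def cFun (lam : ℝ) : ℝ := lam / 2 * coth (lam / 2)

theorem cFun_pos {lam : ℝ} (h : lam ≠ 0) : 0 < cFun lam := by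
  have hx : lam / 2 ≠ 0 := by positivity
  unfold cFun coth
  generalize lam / 2 = x at hx
  have hc := Real.cosh_pos x
  have key : 0 < x / Real.sinh x := by
    rcases lt_or_gt_of_ne hx with h1 | h1
    · exact div_pos_of_neg_of_neg h1 (Real.sinh_neg_iff.mpr h1)
    · exact div_pos h1 (Real.sinh_pos_iff.mpr h1)
  have e : x * (Real.cosh x / Real.sinh x) = Real.cosh x * (x / Real.sinh x) := by ring
  rw [e]
  positivity

/-! ### Operators on Schwartz functions -/

theorem hasTemperateGrowth_cexp {n : ℕ} (L : RR n →L[ℝ] ℝ) :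
    (fun x : RR n => Complex.exp (Complex.I * (L x : ℂ))).HasTemperateGrowth := by
  have h1 : (fun t : ℝ => Complex.exp (Complex.I * (t : ℂ))).HasTemperateGrowth := by
    have hd : ∀ m : ℕ, iteratedDeriv m (fun t : ℝ => Complex.exp (Complex.I * (t : ℂ)))
        = fun t : ℝ => Complex.I ^ m * Complex.exp (Complex.I * (t : ℂ)) := by
      intro m
      induction m with
      | zero => simp
      | succ k ih =>
        rw [iteratedDeriv_succ, ih]
        funext t
        have h0 : HasDerivAt (fun t : ℝ => Complex.I * (t : ℂ)) (Complex.I * 1) t :=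
          (Complex.ofRealCLM.hasDerivAt (x := t)).const_mul Complex.I
        have h2 := (h0.cexp).const_mul (Complex.I ^ k)
        rw [h2.deriv]
        ring
    refine ⟨(contDiff_const.mul Complex.ofRealCLM.contDiff).cexp, fun m => ⟨0, 1, fun t => ?_⟩⟩
    rw [norm_iteratedFDeriv_eq_norm_iteratedDeriv, hd]
    simp [Complex.norm_exp]
  exact h1.comp L.hasTemperateGrowth

/-- `x ↦ [x, ξ]` as a continuous linear functional. -/
def sympCLM {n : ℕ} (ξ : RR n) : RR n →L[ℝ] ℝ :=
  LinearMap.toContinuousLinearMap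
    { toFun := fun x => symp x ξ
      map_add' := fun x y => by
        simp only [symp, PiLp.add_apply, ← Finset.sum_add_distrib]
        exact Finset.sum_congr rfl fun i _ => by ring
      map_smul' := fun r x => by
        simp only [symp, PiLp.smul_apply, smul_eq_mul, RingHom.id_apply, Finset.mul_sum]
        exact Finset.sum_congr rfl fun i _ => by ring }

/-- The twisted translation `(τ_λ(ξ) g)(x) = g(x - ξ) exp(-i(λ/2)[x,ξ])` on Schwartz functions. -/
def twTrans {n : ℕ} (lam : ℝ) (ξ : RR n) : 𝓢(RR n, ℂ) →L[ℂ] 𝓢(RR n, ℂ) :=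
  SchwartzMap.smulLeftCLM ℂ 
      (fun x : RR n => Complex.exp (Complex.I * ((-(lam / 2) * symp x ξ : ℝ) : ℂ)))
    ∘L SchwartzMap.compSubConstCLM ℂ ξ

theorem twTrans_growth {n : ℕ} (lam : ℝ) (ξ : RR n) :
    (fun x : RR n => Complex.exp
      (Complex.I * ((-(lam / 2) * symp x ξ : ℝ) : ℂ))).HasTemperateGrowth :=
  hasTemperateGrowth_cexp ((-(lam / 2)) • sympCLM ξ)

theorem twTrans_apply {n : ℕ} (lam : ℝ) (ξ : RR n) (g : 𝓢(RR n, ℂ)) (x : RR n) :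
    twTrans lam ξ g x
      = Complex.exp (Complex.I * ((-(lam / 2) * symp x ξ : ℝ) : ℂ)) * g (x - ξ) := by
  simp only [twTrans, ContinuousLinearMap.comp_apply]
  rw [SchwartzMap.smulLeftCLM_apply_apply (twTrans_growth lam ξ)]
  rfl

/-- The twisted modulation
`(e_λ(a,b) g)(x,u) = g(x - tanh(λ/2) b, u + tanh(λ/2) a) exp(-i(λ/2) coth(λ/2) (x·a + u·b))`
on Schwartz functions. -/
def twMod {n : ℕ} (lam : ℝ) (η : RR n) : 𝓢(RR n, ℂ) →L[ℂ] 𝓢(RR n, ℂ) :=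
  SchwartzMap.smulLeftCLM ℂ
      (fun x : RR n => Complex.exp
        (Complex.I * ((-(lam / 2 * coth (lam / 2)) * inner ℝ η x : ℝ) : ℂ)))
    ∘L SchwartzMap.compSubConstCLM ℂ (Real.tanh (lam / 2) • rotJ η)

theorem twMod_growth {n : ℕ} (lam : ℝ) (η : RR n) :
    (fun x : RR n => Complex.exp
      (Complex.I * ((-(lam / 2 * coth (lam / 2)) * inner ℝ η x : ℝ) : ℂ))).HasTemperateGrowth :=
  hasTemperateGrowth_cexp ((-(lam / 2 * coth (lam / 2))) • innerSL ℝ η)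

theorem twMod_apply {n : ℕ} (lam : ℝ) (η : RR n) (g : 𝓢(RR n, ℂ)) (x : RR n) :
    twMod lam η g x
      = Complex.exp (Complex.I * ((-(lam / 2 * coth (lam / 2)) * inner ℝ η x : ℝ) : ℂ))
        * g (x - Real.tanh (lam / 2) • rotJ η) := by
  simp only [twMod, ContinuousLinearMap.comp_apply]
  rw [SchwartzMap.smulLeftCLM_apply_apply (twMod_growth lam η)]
  rfl

/-- `Π_λ(ξ,η) = exp(i(λ/2)(coth λ) ξ·η) e_λ(η) τ_λ(ξ)` on Schwartz functions. -/
def twPi {n : ℕ} (lam : ℝ) (ξ η : RR n) : 𝓢(RR n, ℂ) →L[ℂ] 𝓢(RR n, ℂ) :=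
  Complex.exp (Complex.I * ((lam / 2 * coth lam * inner ℝ ξ η : ℝ) : ℂ)) •
    (twMod lam η ∘L twTrans lam ξ)

/-- The factor `c(λ) / (2π)` as a non-zero real number. -/
def scale (lam : ℝ) (h : lam ≠ 0) : ℝˣ :=
  Units.mk0 (cFun lam / (2 * Real.pi)) (div_pos (cFun_pos h) (by positivity)).ne'

/-- The operator `(U_λ g)(x) = c(λ)ⁿ ĝ(c(λ) x)` on Schwartz functions, where
`ĝ(ω) = (2π)⁻ⁿ ∫ exp(-i y·ω) g(y) dy` is the unitary Fourier transform on `ℝ²ⁿ`;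
Mathlib's `𝓕` has the kernel `exp(-2πi y·ω)`. -/
def twU {n : ℕ} (lam : ℝ) (h : lam ≠ 0) : 𝓢(RR n, ℂ) →L[ℂ] 𝓢(RR n, ℂ) :=
  (((cFun lam ^ n * ((2 * Real.pi) ^ n)⁻¹ : ℝ) : ℂ)) •
    (SchwartzMap.compCLMOfContinuousLinearEquiv ℂ
        (ContinuousLinearEquiv.smulLeft (M₁ := RR n) (R₁ := ℝ) (scale lam h))
      ∘L FourierTransform.fourierCLM ℂ 𝓢(RR n, ℂ))

/-- The adjoint `(U_λ* g)(x) = c(λ)ⁿ ǧ(c(λ) x)` of `U_λ` on Schwartz functions, where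
`ǧ(ω) = (2π)⁻ⁿ ∫ exp(i y·ω) g(y) dy`. -/
def twUadj {n : ℕ} (lam : ℝ) (h : lam ≠ 0) : 𝓢(RR n, ℂ) →L[ℂ] 𝓢(RR n, ℂ) :=
  (((cFun lam ^ n * ((2 * Real.pi) ^ n)⁻¹ : ℝ) : ℂ)) •
    (SchwartzMap.compCLMOfContinuousLinearEquiv ℂ
        (ContinuousLinearEquiv.smulLeft (M₁ := RR n) (R₁ := ℝ) (scale lam h))
      ∘L FourierTransform.fourierInvCLM ℂ 𝓢(RR n, ℂ))

theorem twU_apply {n : ℕ} (lam : ℝ) (h : lam ≠ 0) (g : 𝓢(RR n, ℂ)) (x : RR n) :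
    twU lam h g x = (cFun lam : ℂ) ^ n * (((2 * Real.pi : ℝ) : ℂ) ^ n)⁻¹ *
      ∫ y : RR n, Complex.exp (-(Complex.I * ((inner ℝ y (cFun lam • x) : ℝ) : ℂ))) * g y := by
  have e : twU lam h g x = (((cFun lam ^ n * ((2 * Real.pi) ^ n)⁻¹ : ℝ) : ℂ)) *
      𝓕 (g : RR n → ℂ) ((cFun lam / (2 * Real.pi)) • x) := rfl
  rw [e, Real.fourier_eq']
  congr 1
  · push_cast
    rfl
  · refine integral_congr_ae (Filter.Eventually.of_forall fun y => ?_)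
    simp only [smul_eq_mul]
    congr 2
    rw [inner_smul_right, inner_smul_right]
    push_cast
    have : (Real.pi : ℂ) ≠ 0 := by exact_mod_cast Real.pi_ne_zero
    field_simp

theorem twUadj_apply {n : ℕ} (lam : ℝ) (h : lam ≠ 0) (g : 𝓢(RR n, ℂ)) (x : RR n) :
    twUadj lam h g x = (cFun lam : ℂ) ^ n * (((2 * Real.pi : ℝ) : ℂ) ^ n)⁻¹ *
      ∫ y : RR n, Complex.exp (Complex.I * ((inner ℝ y (cFun lam • x) : ℝ) : ℂ)) * g y := by
  have e : twUadj lam h g x = (((cFun lam ^ n * ((2 * Real.pi) ^ n)⁻¹ : ℝ) : ℂ)) *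
      (𝓕⁻ g) ((cFun lam / (2 * Real.pi)) • x) := rfl
  rw [e, SchwartzMap.fourierInv_coe, Real.fourierInv_eq']
  congr 1
  · push_cast
    rfl
  · refine integral_congr_ae (Filter.Eventually.of_forall fun y => ?_)
    simp only [smul_eq_mul]
    congr 2
    rw [inner_smul_right, inner_smul_right]
    push_cast
    have : (Real.pi : ℂ) ≠ 0 := by exact_mod_cast Real.pi_ne_zero
    field_simp

/-! ### Operators on tempered distributions

For a tempered distribution `f` and a Schwartz function `g`, the pairing `⟨f, g⟩` extends the
inner product `∫ f conj(g)` of `L²(ℝ²ⁿ)`.  An operator `T` is extended to tempered distributions by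
duality: `⟨T f, g⟩ = ⟨f, T* g⟩`. -/

/-- The complex conjugate of a Schwartz function. -/
def conjS {n : ℕ} : 𝓢(RR n, ℂ) →L[ℝ] 𝓢(RR n, ℂ) :=
  SchwartzMap.postcompCLM (Complex.conjCLE : ℂ →L[ℝ] ℂ)

theorem conjS_apply {n : ℕ} (g : 𝓢(RR n, ℂ)) (x : RR n) : conjS g x = conj (g x) := rfl

theorem conjS_conjS {n : ℕ} (g : 𝓢(RR n, ℂ)) : conjS (conjS g) = g := by
  ext x
  simp [conjS_apply]

theorem conjS_smul {n : ℕ} (c : ℂ) (g : 𝓢(RR n, ℂ)) : conjS (c • g) = conj c • conjS g := by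
  ext x
  simp [conjS_apply]

/-- The sesquilinear pairing `⟨f, g⟩ = f(conj g)`. -/
def pair {n : ℕ} (f : 𝓢'(RR n, ℂ)) (g : 𝓢(RR n, ℂ)) : ℂ := f (conjS g)

theorem pair_toTempered {n : ℕ} (f g : 𝓢(RR n, ℂ)) :
    pair (SchwartzMap.toTemperedDistributionCLM (RR n) ℂ volume f) g = ∫ x, f x * conj (g x) := by
  simp [pair, conjS_apply, mul_comm]

/-- The operator `g ↦ conj(A(conj g))`. -/
def conjOp {n : ℕ} (A : 𝓢(RR n, ℂ) →L[ℂ] 𝓢(RR n, ℂ)) : 𝓢(RR n, ℂ) →L[ℂ] 𝓢(RR n, ℂ) where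
  toFun g := conjS (A (conjS g))
  map_add' g h := by simp
  map_smul' c g := by simp [conjS_smul]
  cont := conjS.continuous.comp (A.continuous.comp conjS.continuous)

/-- The operator `f ↦ (g ↦ ⟨f, A g⟩)` on tempered distributions: it extends the operator whose
`L²`-adjoint is `A`. -/
def dualExt {n : ℕ} (A : 𝓢(RR n, ℂ) →L[ℂ] 𝓢(RR n, ℂ)) : 𝓢'(RR n, ℂ) →L[ℂ] 𝓢'(RR n, ℂ) :=
  PointwiseConvergenceCLM.precomp ℂ (conjOp A)

theorem pair_dualExt {n : ℕ} (A : 𝓢(RR n, ℂ) →L[ℂ] 𝓢(RR n, ℂ)) (f : 𝓢'(RR n, ℂ))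
    (g : 𝓢(RR n, ℂ)) : pair (dualExt A f) g = pair f (A g) := by
  change f (conjS (A (conjS (conjS g)))) = _
  rw [conjS_conjS]
  rfl

/-- The twisted translation `τ_λ(ξ)` on tempered distributions; its adjoint is `τ_λ(-ξ)`. -/
def twTransD {n : ℕ} (lam : ℝ) (ξ : RR n) : 𝓢'(RR n, ℂ) →L[ℂ] 𝓢'(RR n, ℂ) :=
  dualExt (twTrans lam (-ξ))

/-- The twisted modulation `e_λ(η)` on tempered distributions; its adjoint is `e_λ(-η)`. -/
def twModD {n : ℕ} (lam : ℝ) (η : RR n) : 𝓢'(RR n, ℂ) →L[ℂ] 𝓢'(RR n, ℂ) :=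
  dualExt (twMod lam (-η))

/-- `Π_λ(ξ,η) = exp(i(λ/2)(coth λ) ξ·η) e_λ(η) τ_λ(ξ)` on tempered distributions. -/
def twPiD {n : ℕ} (lam : ℝ) (ξ η : RR n) : 𝓢'(RR n, ℂ) →L[ℂ] 𝓢'(RR n, ℂ) :=
  Complex.exp (Complex.I * ((lam / 2 * coth lam * inner ℝ ξ η : ℝ) : ℂ)) •
    (twModD lam η ∘L twTransD lam ξ)

/-- The operator `U_λ` on tempered distributions. -/
def twUD {n : ℕ} (lam : ℝ) (h : lam ≠ 0) : 𝓢'(RR n, ℂ) →L[ℂ] 𝓢'(RR n, ℂ) :=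
  dualExt (twUadj lam h)

/-- The operator `U_λ*` on tempered distributions. -/
def twUadjD {n : ℕ} (lam : ℝ) (h : lam ≠ 0) : 𝓢'(RR n, ℂ) →L[ℂ] 𝓢'(RR n, ℂ) :=
  dualExt (twU lam h)

/-! The operators on tempered distributions extend those on Schwartz functions. -/

theorem dualExt_toTempered {n : ℕ} {A B : 𝓢(RR n, ℂ) →L[ℂ] 𝓢(RR n, ℂ)} {g : 𝓢(RR n, ℂ)}
    (hAB : ∀ k : 𝓢(RR n, ℂ), ∫ x, A g x * conj (k x) = ∫ x, g x * conj (B k x)) :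
    dualExt B (SchwartzMap.toTemperedDistributionCLM (RR n) ℂ volume g)
      = SchwartzMap.toTemperedDistributionCLM (RR n) ℂ volume (A g) := by
  ext k
  have h1 := pair_dualExt B (SchwartzMap.toTemperedDistributionCLM (RR n) ℂ volume g) (conjS k)
  have h2 := hAB (conjS k)
  rw [pair_toTempered, ← h2, ← pair_toTempered] at h1
  simpa [pair, conjS_conjS] using h1

theorem symp_self {n : ℕ} (ξ : RR n) : symp ξ ξ = 0 := by simp [symp]

theorem symp_neg {n : ℕ} (x ξ : RR n) : symp x (-ξ) = -symp x ξ := by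
  simp only [symp, PiLp.neg_apply, ← Finset.sum_neg_distrib]
  exact Finset.sum_congr rfl fun i _ => by ring

theorem symp_add_left {n : ℕ} (x y ξ : RR n) : symp (x + y) ξ = symp x ξ + symp y ξ :=
  (sympCLM ξ).map_add x y

theorem rotJ_neg {n : ℕ} (ξ : RR n) : rotJ (-ξ) = -rotJ ξ := by
  ext j
  cases j <;> simp [rotJ]

theorem inner_rotJ {n : ℕ} (ξ : RR n) : inner ℝ ξ (rotJ ξ) = 0 := by
  simp [PiLp.inner_apply, rotJ, mul_comm]

theorem conj_cexp_I (t : ℝ) :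
    conj (Complex.exp (Complex.I * (t : ℂ))) = Complex.exp (Complex.I * ((-t : ℝ) : ℂ)) := by
  rw [← Complex.exp_conj]
  simp

theorem twTransD_toTempered {n : ℕ} (lam : ℝ) (ξ : RR n) (g : 𝓢(RR n, ℂ)) :
    twTransD lam ξ (SchwartzMap.toTemperedDistributionCLM (RR n) ℂ volume g)
      = SchwartzMap.toTemperedDistributionCLM (RR n) ℂ volume (twTrans lam ξ g) := by
  refine dualExt_toTempered fun k => ?_
  rw [← integral_add_right_eq_self _ ξ]
  refine integral_congr_ae (Filter.Eventually.of_forall fun x => ?_)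
  simp only [twTrans_apply, map_mul, conj_cexp_I, symp_neg, symp_add_left, symp_self,
    add_sub_cancel_right, sub_neg_eq_add]
  rw [show -(lam / 2) * (symp x ξ + 0) = -(-(lam / 2) * -symp x ξ) by ring]
  ring

theorem twModD_toTempered {n : ℕ} (lam : ℝ) (η : RR n) (g : 𝓢(RR n, ℂ)) :
    twModD lam η (SchwartzMap.toTemperedDistributionCLM (RR n) ℂ volume g)
      = SchwartzMap.toTemperedDistributionCLM (RR n) ℂ volume (twMod lam η g) := by
  refine dualExt_toTempered fun k => ?_
  rw [← integral_add_right_eq_self _ (Real.tanh (lam / 2) • rotJ η)]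
  refine integral_congr_ae (Filter.Eventually.of_forall fun x => ?_)
  simp only [twMod_apply, map_mul, conj_cexp_I, rotJ_neg, inner_add_right, inner_neg_left,
    inner_smul_right, inner_rotJ, add_sub_cancel_right, smul_neg, sub_neg_eq_add, mul_zero,
    add_zero]
  rw [show -(lam / 2 * coth (lam / 2)) * inner ℝ η x
    = -(-(lam / 2 * coth (lam / 2)) * -inner ℝ η x) by ring]
  ring

theorem twU_adjoint {n : ℕ} (lam : ℝ) (h : lam ≠ 0) (g k : 𝓢(RR n, ℂ)) :
    ∫ x, twU lam h g x * conj (k x) = ∫ x, g x * conj (twUadj lam h k x) := by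
  set r : ℝ := cFun lam / (2 * Real.pi) with hr
  let L : RR n →ₗ[ℝ] RR n →ₗ[ℝ] ℝ := r • innerₗ (RR n)
  have hL : Continuous fun p : RR n × RR n => L p.1 p.2 := by
    change Continuous fun p : RR n × RR n => r * inner ℝ p.1 p.2
    fun_prop
  have hk : Integrable (fun x => conj (k x)) := (conjS k).integrable
  have main := VectorFourier.integral_bilin_fourierIntegral_eq_flip (μ := volume) (ν := volume)
    (ContinuousLinearMap.mul ℂ ℂ) Real.continuous_fourierChar hL g.integrable hk
  have e1 : ∀ x, twU lam h g x = (((cFun lam ^ n * ((2 * Real.pi) ^ n)⁻¹ : ℝ) : ℂ)) *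
      VectorFourier.fourierIntegral Real.fourierChar volume L g x := by
    intro x
    have e : twU lam h g x = (((cFun lam ^ n * ((2 * Real.pi) ^ n)⁻¹ : ℝ) : ℂ)) *
      𝓕 (g : RR n → ℂ) (r • x) := rfl
    rw [e, Real.fourier_eq, VectorFourier.fourierIntegral]
    congr 1
    refine integral_congr_ae (Filter.Eventually.of_forall fun y => ?_)
    simp only [inner_smul_right]
    rfl
  have e2 : ∀ x, conj (twUadj lam h k x) = (((cFun lam ^ n * ((2 * Real.pi) ^ n)⁻¹ : ℝ) : ℂ)) *
      VectorFourier.fourierIntegral Real.fourierChar volume L.flip (fun x => conj (k x)) x := by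
    intro x
    have e : twUadj lam h k x = (((cFun lam ^ n * ((2 * Real.pi) ^ n)⁻¹ : ℝ) : ℂ)) *
      (𝓕⁻ k) (r • x) := rfl
    rw [e, SchwartzMap.fourierInv_coe, Real.fourierInv_eq, VectorFourier.fourierIntegral, map_mul,
      Complex.conj_ofReal, ← integral_conj]
    congr 1
    refine integral_congr_ae (Filter.Eventually.of_forall fun y => ?_)
    have hy : L.flip y x = r * inner ℝ x y := rfl
    simp only [hy, inner_smul_right, Circle.smul_def, smul_eq_mul, map_mul,
      real_inner_comm x y, AddChar.map_neg_eq_inv, Circle.coe_inv_eq_conj]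
  simp only [e1, e2]
  simp only [ContinuousLinearMap.mul_apply'] at main
  simp only [mul_assoc, integral_const_mul, main]
  rw [← integral_const_mul]
  refine integral_congr_ae (Filter.Eventually.of_forall fun y => ?_)
  simp only
  ring

theorem twUD_toTempered {n : ℕ} (lam : ℝ) (h : lam ≠ 0) (g : 𝓢(RR n, ℂ)) :
    twUD lam h (SchwartzMap.toTemperedDistributionCLM (RR n) ℂ volume g)
      = SchwartzMap.toTemperedDistributionCLM (RR n) ℂ volume (twU lam h g) :=
  dualExt_toTempered (twU_adjoint lam h g)

/-! ### The twisted Bargmann transform and the representation on the twisted Fock space -/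

/-- The holomorphic extension to `ℂ²ⁿ` of the heat kernel
`p_t^λ(ξ) = (4π)⁻ⁿ λⁿ (sinh tλ)⁻ⁿ exp(-(λ/4) coth(tλ) |ξ|²)` of the special Hermite operator. -/
def heatKernel {n : ℕ} (lam t : ℝ) (ζ : CC n) : ℂ :=
  (((4 * Real.pi) ^ n)⁻¹ * lam ^ n * (Real.sinh (t * lam) ^ n)⁻¹ : ℝ) *
    Complex.exp (-((lam / 4 * coth (t * lam) : ℝ) : ℂ) * cdot ζ ζ)

/-- `c_λ = (4π)⁻ⁿ λⁿ (sinh λ)⁻ⁿ`. -/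
def cConst (n : ℕ) (lam : ℝ) : ℝ :=
  ((4 * Real.pi) ^ n)⁻¹ * lam ^ n * (Real.sinh lam ^ n)⁻¹

/-- The twisted Bargmann transform `B_λ g(ζ) = c_λ p_1^λ(ζ)⁻¹ (g *_λ p_{1/2}^λ)(ζ)`, where
`(g *_λ p)(ζ) = ∫ g(η) p(ζ - η) exp(-i(λ/2)[ζ,η]) dη` is the twisted convolution, extended
holomorphically to `ℂ²ⁿ`. -/
def bargmann {n : ℕ} (lam : ℝ) (g : RR n → ℂ) (ζ : CC n) : ℂ :=
  (cConst n lam : ℂ) * (heatKernel lam 1 ζ)⁻¹ *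
    ∫ η : RR n, g η * heatKernel lam (1 / 2) (ζ - toCC η) *
      Complex.exp (-(Complex.I * (lam / 2 : ℝ)) * csymp ζ (toCC η))

/-- The operator `ρ_λ(ζ')` of the twisted Fock space:
`ρ_λ(ζ')F(ζ) = F(ζ-ζ') exp((λ/2)(coth λ) ζ·conj ζ') exp(-i(λ/2)[ζ, conj ζ'])
  exp(-(λ/4)(coth λ)|ζ'|²) exp((λ/2)[Re ζ', Im ζ'])`. -/
def fockRep {n : ℕ} (lam : ℝ) (ζ' : CC n) (F : CC n → ℂ) (ζ : CC n) : ℂ :=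
  F (ζ - ζ') * Complex.exp ((lam / 2 * coth lam : ℝ) * cdot ζ (conjCC ζ')) *
    Complex.exp (-(Complex.I * (lam / 2 : ℝ)) * csymp ζ (conjCC ζ')) *
    Complex.exp ((-(lam / 4 * coth lam * ‖ζ'‖ ^ 2) : ℝ) : ℂ) *
    Complex.exp ((lam / 2 * symp (reCC ζ') (imCC ζ') : ℝ) : ℂ)

/-! ### Twisted modulation spaces -/

/-- Membership of `F(ξ,η)` in the mixed norm space `L^{p,q}(ℝ²ⁿ × ℝ²ⁿ)`: the `L^p` norm is taken
in the first variable, then the `L^q` norm in the second. -/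
def MemMixedLp {n : ℕ} (p q : ℝ≥0∞) (F : RR n → RR n → ℂ) : Prop :=
  AEStronglyMeasurable (Function.uncurry F) volume ∧
    eLpNorm (fun η => eLpNorm (fun ξ => F ξ η) p volume) q volume < ∞

/-- The twisted modulation space `M_λ^{p,q}(ℝ²ⁿ)`: the tempered distributions `f` for which the
matrix coefficient `⟨f, Π_λ(ξ,η)g⟩` belongs to `L^{p,q}` for some non-zero Schwartz window `g`. -/
def modSpace (n : ℕ) (lam : ℝ) (p q : ℝ≥0∞) : Set 𝓢'(RR n, ℂ) :=
  {f | ∃ g : 𝓢(RR n, ℂ), g ≠ 0 ∧ MemMixedLp p q fun ξ η => pair f (twPi lam ξ η g)}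

end TwistedMod

end

noncomputable section

namespace TwistedMod

/-! ### Hyperbolic identities and the rotation `J` -/

/-! Everything reduces to one observation (`twPi_isWeyl`): Π_λ(ξ,η) is the symmetrized Weyl operator
g ↦ exp(i(b·x - a·b/2)) g(x - a), with a = ξ + tanh(λ/2) Jη and b = (λ/2) Jξ - c(λ) η. Since a and b
are linear in (ξ,η), these operators compose additively up to a unimodular factor (`twPi_twPi`). As
τ_λ and e_λ are Π_λ with one argument zero, applying them to f only translates the matrix
coefficient of f and multiplies it by a phase, which L^{p,q} does not notice.

The operator U_λ is a rescaled Fourier transform, hence sends the Weyl data (a,b) to (b/c, -ca).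
Because c(λ) tanh(λ/2) = λ/2, this is the substitution (ξ,η) ↦ (-η,ξ) (`twU_twPi`). Together with
unitarity (`twU_twUadj`, `twUadj_twU`) and duality it gives the conjugation formula. It also shows
that the coefficient of U_λ f for the window U_λ g is that of f for g, rotated; when p = q the
rotation preserves the norm by Tonelli.

For the Bargmann transform, completing the exponent gives B_λ g(ζ) = D exp(κ ζ·ζ) ∫ g(x) exp(-(c/2)
x·x + v(ζ)·x) dx with v linear (`exists_bargmann_eq`). A Weyl operator on g shifts v(ζ) by v(ξ+iη),
and U_λ multiplies it by -i; it remains to compare the scalar exponents. -/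

theorem tanh_mul_coth {s : ℝ} (hs : s ≠ 0) : Real.tanh s * coth s = 1 := by
  have h1 : Real.sinh s ≠ 0 := Real.sinh_eq_zero.not.mpr hs
  have h2 := (Real.cosh_pos s).ne'
  rw [coth, Real.tanh_eq_sinh_div_cosh]
  field_simp

/-- With s = λ, this identity makes the coth λ factor in Π_λ exactly the symmetrizing phase, and
later simplifies the quotient of heat kernels at times 1/2 and 1. -/
theorem coth_eq_half {s : ℝ} (hs : s ≠ 0) :
    coth s = (coth (s / 2) + Real.tanh (s / 2)) / 2 := by
  have h1 : Real.sinh (s / 2) ≠ 0 := Real.sinh_eq_zero.not.mpr (by positivity)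
  have h2 := (Real.cosh_pos (s / 2)).ne'
  obtain ⟨t, rfl⟩ : ∃ t, s = 2 * t := ⟨s / 2, by ring⟩
  rw [mul_div_cancel_left₀ _ two_ne_zero] at *
  rw [coth, coth, Real.tanh_eq_sinh_div_cosh, Real.sinh_two_mul, Real.cosh_two_mul]
  field_simp

theorem rotJ_add {n : ℕ} (ξ η : RR n) : rotJ (ξ + η) = rotJ ξ + rotJ η := by
  ext j
  cases j <;> simp [rotJ, add_comm]

/-- The twist in τ_λ(ξ) thus becomes an ordinary modulation of frequency (λ/2) Jξ. -/
theorem symp_eq_inner {n : ℕ} (x ξ : RR n) : symp x ξ = -inner ℝ (rotJ ξ) x := by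
  simp only [symp, PiLp.inner_apply, rotJ, Fintype.sum_sum_type, Sum.elim_inl, Sum.elim_inr,
    ← Finset.sum_add_distrib, ← Finset.sum_neg_distrib]
  refine Finset.sum_congr rfl fun i _ => ?_
  simp
  ring

theorem inner_rotJ_rotJ {n : ℕ} (ξ η : RR n) : inner ℝ (rotJ ξ) (rotJ η) = inner ℝ ξ η := by
  simp [PiLp.inner_apply, rotJ, add_comm]

theorem rotJ_zero {n : ℕ} : rotJ (0 : RR n) = 0 := by
  ext j
  cases j <;> simp [rotJ]

/-! ### Weyl operators -/

/-- The phase `exp(it)`. -/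
def phase (t : ℝ) : ℂ := Complex.exp (Complex.I * (t : ℂ))

theorem phase_add (s t : ℝ) : phase (s + t) = phase s * phase t := by
  rw [phase, phase, phase, ← Complex.exp_add]
  push_cast
  ring_nf

theorem phase_zero : phase 0 = 1 := by simp [phase]

theorem norm_phase (t : ℝ) : ‖phase t‖ = 1 := by simp [phase, Complex.norm_exp]

theorem conj_phase (t : ℝ) : conj (phase t) = phase (-t) := conj_cexp_I t

theorem continuous_phase : Continuous phase := by
  unfold phase
  fun_prop

/-- `h` is the image of `g` under the symmetrized Weyl operator with translation `a` and
frequency `b`. -/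
def IsWeyl {n : ℕ} (a b : RR n) (g h : RR n → ℂ) : Prop :=
  ∀ x, h x = phase (inner ℝ b x - inner ℝ a b / 2) * g (x - a)

/-- The translation part of `Π_λ(ξ,η)`. -/
def weylShift {n : ℕ} (lam : ℝ) (ξ η : RR n) : RR n := ξ + Real.tanh (lam / 2) • rotJ η

/-- The frequency part of `Π_λ(ξ,η)`. -/
def weylFreq {n : ℕ} (lam : ℝ) (ξ η : RR n) : RR n := (lam / 2) • rotJ ξ - cFun lam • η

theorem lam_eq {lam : ℝ} (hlam : lam ≠ 0) : lam / 2 = cFun lam * Real.tanh (lam / 2) := by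
  have h := tanh_mul_coth (s := lam / 2) (by positivity)
  rw [cFun]
  linear_combination (-lam / 2) * h

/-- Since Jξ ⊥ ξ and J is an isometry, all constant phases are multiples of ξ·η; they agree because
coth λ is the mean of coth(λ/2) and tanh(λ/2). -/
theorem twPi_isWeyl {n : ℕ} {lam : ℝ} (hlam : lam ≠ 0) (ξ η : RR n) (g : 𝓢(RR n, ℂ)) :
    IsWeyl (weylShift lam ξ η) (weylFreq lam ξ η) g (twPi lam ξ η g) := by
  intro x
  have e : twPi lam ξ η g x = phase (lam / 2 * coth lam * inner ℝ ξ η) *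
      twMod lam η (twTrans lam ξ g) x := rfl
  rw [e, twMod_apply, twTrans_apply, ← phase, ← phase, ← mul_assoc, ← mul_assoc, ← phase_add,
    ← phase_add, sub_sub, add_comm _ ξ]
  congr 2
  have h0 : inner ℝ (rotJ η) η = 0 := by rw [real_inner_comm, inner_rotJ]
  simp only [symp_eq_inner, weylShift, weylFreq, inner_sub_right, inner_sub_left, inner_add_left,
    inner_smul_left, inner_smul_right, inner_rotJ_rotJ, inner_rotJ, real_inner_comm ξ η,
    coth_eq_half hlam, h0, cFun, conj_trivial]
  ring

theorem weylShift_add {n : ℕ} (lam : ℝ) (ξ η ξ' η' : RR n) :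
    weylShift lam (ξ + ξ') (η + η') = weylShift lam ξ η + weylShift lam ξ' η' := by
  simp only [weylShift, rotJ_add, smul_add]
  abel

theorem weylFreq_add {n : ℕ} (lam : ℝ) (ξ η ξ' η' : RR n) :
    weylFreq lam (ξ + ξ') (η + η') = weylFreq lam ξ η + weylFreq lam ξ' η' := by
  simp only [weylFreq, rotJ_add, smul_add]
  abel

theorem twPi_zero_right {n : ℕ} (lam : ℝ) (ξ : RR n) : twPi lam ξ 0 = twTrans lam ξ := by
  ext g x
  have e : twPi lam ξ 0 g x = phase (lam / 2 * coth lam * inner ℝ ξ (0 : RR n)) *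
      twMod lam 0 (twTrans lam ξ g) x := rfl
  rw [e, twMod_apply]
  simp [rotJ_zero, phase_zero]

theorem twPi_zero_left {n : ℕ} (lam : ℝ) (η : RR n) : twPi lam 0 η = twMod lam η := by
  ext g x
  have e : twPi lam 0 η g x = phase (lam / 2 * coth lam * inner ℝ (0 : RR n) η) *
      twMod lam η (twTrans lam 0 g) x := rfl
  rw [e, twMod_apply, twMod_apply, twTrans_apply]
  simp [symp_eq_inner, rotJ_zero, phase_zero]

/-- The symplectic form governing the composition of Weyl operators. -/
def weylForm {n : ℕ} (lam : ℝ) (ξ η ξ' η' : RR n) : ℝ :=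
  (inner ℝ (weylShift lam ξ' η') (weylFreq lam ξ η)
    - inner ℝ (weylShift lam ξ η) (weylFreq lam ξ' η')) / 2

theorem twPi_twPi {n : ℕ} {lam : ℝ} (hlam : lam ≠ 0) (ξ η ξ' η' : RR n) (g : 𝓢(RR n, ℂ)) :
    twPi lam ξ η (twPi lam ξ' η' g)
      = phase (weylForm lam ξ η ξ' η') • twPi lam (ξ + ξ') (η + η') g := by
  ext x
  rw [_root_.smul_apply, smul_eq_mul, twPi_isWeyl hlam, twPi_isWeyl hlam, twPi_isWeyl hlam,
    weylShift_add, weylFreq_add, ← mul_assoc, ← mul_assoc, ← phase_add, ← phase_add, sub_sub]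
  congr 2
  simp only [weylForm, inner_sub_right, inner_add_left, inner_add_right,
    real_inner_comm (weylShift lam ξ η) (weylFreq lam ξ' η')]
  ring

theorem twMod_twTrans {n : ℕ} (lam : ℝ) (ξ η : RR n) (g : 𝓢(RR n, ℂ)) :
    twMod lam η (twTrans lam ξ g)
      = phase (-(lam / 2 * coth lam * inner ℝ ξ η)) • twPi lam ξ η g := by
  have e : twPi lam ξ η g = phase (lam / 2 * coth lam * inner ℝ ξ η) •
      twMod lam η (twTrans lam ξ g) := rfl
  rw [e, smul_smul, ← phase_add, neg_add_cancel, phase_zero, one_smul]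

/-- Needed because duality reverses the order of the factors of Π_λ; the phase here is opposite to
that in `twMod_twTrans`. -/
theorem twTrans_twMod {n : ℕ} {lam : ℝ} (hlam : lam ≠ 0) (ξ η : RR n) (g : 𝓢(RR n, ℂ)) :
    twTrans lam ξ (twMod lam η g)
      = phase (lam / 2 * coth lam * inner ℝ ξ η) • twPi lam ξ η g := by
  have h1 := twMod_twTrans lam ξ η g
  rw [← twPi_zero_left, ← twPi_zero_right, twPi_twPi hlam, zero_add, add_zero] at h1
  rw [← twPi_zero_left, ← twPi_zero_right, twPi_twPi hlam, zero_add, add_zero]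
  have e1 : weylForm lam ξ 0 0 η = lam / 2 * coth lam * inner ℝ ξ η := by
    simp only [weylForm, weylShift, weylFreq, rotJ_zero, smul_zero, add_zero, zero_add, sub_zero,
      zero_sub, inner_neg_right, inner_smul_left, inner_smul_right, inner_rotJ_rotJ, cFun,
      real_inner_comm ξ η, coth_eq_half hlam, conj_trivial]
    ring
  rw [e1]

/-! ### The operator `U_λ` -/

/-- The Fourier transform exchanges translation and modulation. No extra phase appears, since the
a·b/2 normalization changes sign under (a,b) ↦ (b/c, -ca), which accounts for the phase left by y ↦
y + a. -/
theorem twU_isWeyl {n : ℕ} {lam : ℝ} (hlam : lam ≠ 0) {a b : RR n} {g h : 𝓢(RR n, ℂ)}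
    (hgh : IsWeyl a b g h) :
    IsWeyl ((cFun lam)⁻¹ • b) (-(cFun lam • a)) (twU lam hlam g) (twU lam hlam h) := by
  have hc := (cFun_pos hlam).ne'
  intro x
  rw [twU_apply, twU_apply, mul_left_comm]
  congr 1
  rw [← integral_const_mul, ← integral_add_right_eq_self _ a]
  refine integral_congr_ae (Filter.Eventually.of_forall fun y => ?_)
  have e (t : ℝ) : Complex.exp (-(Complex.I * (t : ℂ))) = phase (-t) := by simp [phase]
  simp only [hgh (y + a), e, ← mul_assoc, ← phase_add, add_sub_cancel_right]
  congr 2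
  simp only [inner_add_left, inner_add_right, inner_sub_right, inner_smul_left, inner_smul_right,
    inner_neg_left, inner_neg_right,
    conj_trivial, real_inner_comm a b, real_inner_comm y b]
  field_simp
  ring

theorem twU_twPi {n : ℕ} {lam : ℝ} (hlam : lam ≠ 0) (ξ η : RR n) (g : 𝓢(RR n, ℂ)) :
    twU lam hlam (twPi lam ξ η g) = twPi lam (-η) ξ (twU lam hlam g) := by
  have hc := (cFun_pos hlam).ne'
  have h1 := twU_isWeyl hlam (twPi_isWeyl hlam ξ η g)
  have h2 := twPi_isWeyl hlam (-η) ξ (twU lam hlam g)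
  have ea : (cFun lam)⁻¹ • weylFreq lam ξ η = weylShift lam (-η) ξ := by
    rw [weylFreq, weylShift, smul_sub, smul_smul, smul_smul, lam_eq hlam, inv_mul_cancel_left₀ hc,
      inv_mul_cancel₀ hc, one_smul, ← lam_eq hlam]
    abel
  have eb : -(cFun lam • weylShift lam ξ η) = weylFreq lam (-η) ξ := by
    rw [weylFreq, weylShift, smul_add, smul_smul, ← lam_eq hlam, rotJ_neg, smul_neg]
    abel
  rw [ea, eb] at h1
  ext x
  rw [h1, h2]

/-- Fourier inversion: the two prefactors rⁿ multiply to r²ⁿ, which cancels the Jacobian of y ↦ r y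
on ℝ²ⁿ. -/
theorem twU_twUadj {n : ℕ} {lam : ℝ} (hlam : lam ≠ 0) (g : 𝓢(RR n, ℂ)) :
    twU lam hlam (twUadj lam hlam g) = g := by
  set r : ℝ := cFun lam / (2 * Real.pi) with hr
  have hr0 : 0 < r := div_pos (cFun_pos hlam) (by positivity)
  have hC : (cFun lam ^ n * ((2 * Real.pi) ^ n)⁻¹ : ℝ) = r ^ n := by
    rw [hr, div_pow, div_eq_mul_inv]
  ext x
  have e : twU lam hlam (twUadj lam hlam g) x = (((cFun lam ^ n * ((2 * Real.pi) ^ n)⁻¹ : ℝ) : ℂ)) *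
      𝓕 (twUadj lam hlam g : RR n → ℂ) (r • x) := rfl
  have e' (y : RR n) : twUadj lam hlam g y = (((cFun lam ^ n * ((2 * Real.pi) ^ n)⁻¹ : ℝ) : ℂ)) *
      (𝓕⁻ g) (r • y) := rfl
  have h3 := MeasureTheory.Measure.integral_comp_smul (μ := (volume : Measure (RR n)))
    (fun y => Real.fourierChar (-(inner ℝ y x)) • (𝓕⁻ g) y) r
  have h4 : 𝓕 (𝓕⁻ g : 𝓢(RR n, ℂ)) x = g x := by rw [FourierTransform.fourier_fourierInv_eq]
  rw [SchwartzMap.fourier_coe, Real.fourier_eq] at h4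
  rw [h4] at h3
  rw [e, Real.fourier_eq, hC]
  simp only [e', hC]
  have h5 : ∀ y : RR n, Real.fourierChar (-(inner ℝ y (r • x))) •
      ((r ^ n : ℝ) * (𝓕⁻ g) (r • y) : ℂ)
      = (r ^ n : ℝ) * (Real.fourierChar (-(inner ℝ (r • y) x)) • (𝓕⁻ g) (r • y)) := by
    intro y
    rw [inner_smul_left, inner_smul_right, mul_smul_comm]
    rfl
  simp only [h5]
  rw [integral_const_mul, h3, finrank_euclideanSpace, Fintype.card_sum, Fintype.card_fin,
    abs_of_pos (by positivity), Complex.real_smul, ← mul_assoc, ← mul_assoc]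
  norm_cast
  rw [← pow_add, mul_inv_cancel₀ (by positivity)]
  simp

/-- Conjugating by complex conjugation turns the right inverse of U_λ into a left inverse. -/
theorem twUadj_eq_conj {n : ℕ} {lam : ℝ} (hlam : lam ≠ 0) (g : 𝓢(RR n, ℂ)) :
    twUadj lam hlam g = conjS (twU lam hlam (conjS g)) := by
  ext x
  rw [conjS_apply, twU_apply, twUadj_apply, map_mul, ← integral_conj]
  congr 1
  · rw [map_mul, map_inv₀, map_pow, map_pow, Complex.conj_ofReal, Complex.conj_ofReal]
  · refine integral_congr_ae (Filter.Eventually.of_forall fun y => ?_)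
    simp [conjS_apply, ← Complex.exp_conj]

theorem twUadj_twU {n : ℕ} {lam : ℝ} (hlam : lam ≠ 0) (g : 𝓢(RR n, ℂ)) :
    twUadj lam hlam (twU lam hlam g) = g := by
  have h := twU_twUadj hlam (conjS g)
  rw [twUadj_eq_conj, conjS_conjS] at h
  rw [twUadj_eq_conj, h, conjS_conjS]

/-! ### Operators on tempered distributions -/

theorem pair_smul_right {n : ℕ} (f : 𝓢'(RR n, ℂ)) (c : ℂ) (g : 𝓢(RR n, ℂ)) :
    pair f (c • g) = conj c * pair f g := by
  rw [pair, conjS_smul, map_smul, smul_eq_mul, pair]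

theorem pair_ext {n : ℕ} {f f' : 𝓢'(RR n, ℂ)} (h : ∀ g, pair f g = pair f' g) : f = f' := by
  ext g
  simpa [pair, conjS_conjS] using h (conjS g)

/-- The phase from commuting τ_λ past e_λ, conjugated by the pairing, cancels the prefactor of Π_λ.
-/
theorem pair_twPiD {n : ℕ} {lam : ℝ} (hlam : lam ≠ 0) (ξ η : RR n) (f : 𝓢'(RR n, ℂ))
    (g : 𝓢(RR n, ℂ)) : pair (twPiD lam ξ η f) g = pair f (twPi lam (-ξ) (-η) g) := by
  have e : pair (twPiD lam ξ η f) g = phase (lam / 2 * coth lam * inner ℝ ξ η) *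
      pair (twModD lam η (twTransD lam ξ f)) g := rfl
  rw [e, twModD, pair_dualExt, twTransD, pair_dualExt, twTrans_twMod hlam, pair_smul_right,
    conj_phase, inner_neg_neg, ← mul_assoc, ← phase_add, add_neg_cancel, phase_zero, one_mul]

theorem twUD_twPiD_twUadjD {n : ℕ} {lam : ℝ} (hlam : lam ≠ 0) (ξ η : RR n) (f : 𝓢'(RR n, ℂ)) :
    twUD lam hlam (twPiD lam ξ η (twUadjD lam hlam f)) = twPiD lam (-η) ξ f := by
  refine pair_ext fun g => ?_
  rw [twUD, pair_dualExt, pair_twPiD hlam, twUadjD, pair_dualExt, twU_twPi, twU_twUadj,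
    pair_twPiD hlam]

/-! ### Invariance properties of mixed norm spaces -/

theorem continuous_rotJ {n : ℕ} : Continuous (rotJ : RR n → RR n) := by
  refine (PiLp.continuous_toLp 2 _).comp (continuous_pi fun j => ?_)
  cases j <;> simp only [Sum.elim_inl, Sum.elim_inr] <;> fun_prop

theorem continuous_weylForm {n : ℕ} (lam : ℝ) (ξ₀ η₀ : RR n) :
    Continuous fun z : RR n × RR n => weylForm lam ξ₀ η₀ z.1 z.2 := by
  have := continuous_rotJ (n := n)
  unfold weylForm weylShift weylFreq
  fun_prop

theorem eLpNorm_comp_add_left {n : ℕ} {E : Type*} [TopologicalSpace E] [ContinuousENorm E]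
    (p : ℝ≥0∞) (F : RR n → E) (a : RR n) :
    eLpNorm (fun x => F (a + x)) p volume = eLpNorm F p volume := by
  have h := (measurableEmbedding_addLeft a).eLpNorm_map_measure (g := F) (p := p)
    (μ := (volume : Measure (RR n)))
  rw [map_add_left_eq_self] at h
  exact h.symm

theorem MemMixedLp.phase_mul_shift {n : ℕ} {p q : ℝ≥0∞} {F : RR n → RR n → ℂ}
    (hF : MemMixedLp p q F) (a b : RR n) {θ : RR n → RR n → ℝ}
    (hθ : Continuous (Function.uncurry θ)) :
    MemMixedLp p q fun ξ η => phase (θ ξ η) * F (a + ξ) (b + η) := by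
  refine ⟨?_, ?_⟩
  · refine (continuous_phase.comp hθ).aestronglyMeasurable.mul ?_
    have h := (measurePreserving_add_left (volume : Measure (RR n)) a).prod
      (measurePreserving_add_left (volume : Measure (RR n)) b)
    exact hF.1.comp_measurePreserving h
  · refine lt_of_eq_of_lt ?_ hF.2
    rw [← eLpNorm_comp_add_left q (fun η => eLpNorm (fun ξ => F ξ η) p volume) b]
    congr 1
    ext η
    rw [← eLpNorm_comp_add_left p (fun ξ => F ξ (b + η)) a]
    exact eLpNorm_congr_norm_ae (Filter.Eventually.of_forall fun ξ => by
      rw [norm_mul, norm_phase, one_mul])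

theorem essSup_essSup_le {α β : Type*} [MeasurableSpace α] [MeasurableSpace β] {μ : Measure α}
    {ν : Measure β} [SFinite μ] [SFinite ν] {G : α × β → ℝ≥0∞} (hG : AEMeasurable G (μ.prod ν)) :
    essSup (fun x => essSup (fun y => G (x, y)) ν) μ
      ≤ essSup (fun y => essSup (fun x => G (x, y)) μ) ν := by
  set M := essSup (fun y => essSup (fun x => G (x, y)) μ) ν
  have h1 := Measure.ae_ae_of_ae_prod hG.ae_eq_mk
  have h2 := Measure.ae_ae_of_ae_prod
    (Measure.measurePreserving_swap.quasiMeasurePreserving.ae hG.ae_eq_mk)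
  have h3 : ∀ᵐ y ∂ν, ∀ᵐ x ∂μ, hG.mk G (x, y) ≤ M := by
    filter_upwards [h2, ENNReal.ae_le_essSup fun y => essSup (fun x => G (x, y)) μ] with y hy hM
    filter_upwards [hy, ENNReal.ae_le_essSup fun x => G (x, y)] with x hx hM'
    have hx' : G (x, y) = hG.mk G (x, y) := hx
    exact hx' ▸ hM'.trans hM
  -- Exchanging the two almost-everywhere quantifiers needs a measurable set, which is why `G` was
  -- replaced by its measurable representative.
  have h4 := (Measure.ae_ae_comm (p := fun x y => hG.mk G (x, y) ≤ M) (measurableSet_le hG.measurable_mk measurable_const)).mpr h3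
  refine essSup_le_of_ae_le _ ?_
  filter_upwards [h1, h4] with x hx hx'
  refine essSup_le_of_ae_le _ ?_
  filter_upwards [hx, hx'] with y hy hy'
  exact hy.le.trans hy'

/-- The iterated `L^p` norm is the `L^p` norm on the product, in either order. -/
theorem eLpNorm_eLpNorm_swap {n : ℕ} {p : ℝ≥0∞} (hp : 1 ≤ p) {F : RR n → RR n → ℂ}
    (hF : AEStronglyMeasurable (Function.uncurry F) volume) :
    eLpNorm (fun η => eLpNorm (fun ξ => F ξ η) p volume) p volume
      = eLpNorm (fun ξ => eLpNorm (fun η => F ξ η) p volume) p volume := by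
  have hF' : AEStronglyMeasurable (Function.uncurry F)
    ((volume : Measure (RR n)).prod (volume : Measure (RR n))) := hF
  have hp0 : p ≠ 0 := (zero_lt_one.trans_le hp).ne'
  -- Tonelli settles finite p; at p = ∞ the iterated essential suprema are compared in both
  -- directions.
  rcases eq_or_ne p ∞ with rfl | hp'
  · simp only [eLpNorm_exponent_top, eLpNormEssSup, enorm_eq_self]
    exact le_antisymm (essSup_essSup_le (G := fun z : RR n × RR n => ‖F z.2 z.1‖ₑ)
        hF'.prod_swap.enorm)
      (essSup_essSup_le (G := fun z : RR n × RR n => ‖F z.1 z.2‖ₑ) hF'.enorm)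
  · have hr : 0 < p.toReal := ENNReal.toReal_pos hp0 hp'
    simp only [eLpNorm_eq_lintegral_rpow_enorm_toReal hp0 hp', enorm_eq_self, ← ENNReal.rpow_mul,
      one_div, inv_mul_cancel₀ hr.ne', ENNReal.rpow_one]
    rw [← lintegral_prod_symm (fun z : RR n × RR n => ‖F z.1 z.2‖ₑ ^ p.toReal)
        (hF'.enorm.pow_const _),
      ← lintegral_prod (fun z : RR n × RR n => ‖F z.1 z.2‖ₑ ^ p.toReal)
        (hF'.enorm.pow_const _)]

theorem MemMixedLp.rotate {n : ℕ} {p : ℝ≥0∞} (hp : 1 ≤ p) {F : RR n → RR n → ℂ}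
    (hF : MemMixedLp p p F) : MemMixedLp p p fun ξ η => F η (-ξ) := by
  have hn := Measure.measurePreserving_neg (volume : Measure (RR n))
  have hm : AEStronglyMeasurable (Function.uncurry fun ξ η => F η (-ξ)) volume := by
    have h := (MeasurePreserving.prod (.id (volume : Measure (RR n))) hn).comp
      (Measure.measurePreserving_swap (μ := (volume : Measure (RR n)))
        (ν := (volume : Measure (RR n))))
    exact hF.1.comp_measurePreserving h
  refine ⟨hm, ?_⟩
  rw [eLpNorm_eLpNorm_swap hp hm]
  refine lt_of_eq_of_lt ?_ hF.2
  have h := (MeasurableEquiv.neg (RR n)).measurableEmbedding.eLpNorm_map_measure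
    (g := fun η => eLpNorm (fun ξ => F ξ η) p volume) (p := p) (μ := (volume : Measure (RR n)))
  rw [show Measure.map (MeasurableEquiv.neg (RR n)) volume = volume from hn.map_eq] at h
  exact h.symm

/-! ### Invariance of the twisted modulation spaces -/

/-- The same window works: by the composition law the new coefficient is the old one translated by
(ξ₀,η₀), times a phase. -/
theorem dualExt_twPi_mem_modSpace {n : ℕ} {lam : ℝ} (hlam : lam ≠ 0) {p q : ℝ≥0∞}
    {f : 𝓢'(RR n, ℂ)} (hf : f ∈ modSpace n lam p q) (ξ₀ η₀ : RR n) :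
    dualExt (twPi lam ξ₀ η₀) f ∈ modSpace n lam p q := by
  obtain ⟨g, hg, hF⟩ := hf
  refine ⟨g, hg, ?_⟩
  have h := hF.phase_mul_shift ξ₀ η₀ (θ := fun ξ η => -weylForm lam ξ₀ η₀ ξ η)
    (continuous_weylForm lam ξ₀ η₀).neg
  simpa only [pair_dualExt, twPi_twPi hlam, pair_smul_right, conj_phase] using h

theorem twUD_mem_modSpace {n : ℕ} {lam : ℝ} (hlam : lam ≠ 0) {p : ℝ≥0∞} (hp : 1 ≤ p)
    {f : 𝓢'(RR n, ℂ)} (hf : f ∈ modSpace n lam p p) :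
    twUD lam hlam f ∈ modSpace n lam p p := by
  obtain ⟨g, hg, hF⟩ := hf
  refine ⟨twU lam hlam g, fun h0 => hg ?_, ?_⟩
  · rw [← twUadj_twU hlam g, h0, map_zero]
  · have e (ξ η : RR n) : pair (twUD lam hlam f) (twPi lam ξ η (twU lam hlam g))
        = pair f (twPi lam η (-ξ) g) := by
      -- Writing ξ as -(-ξ) gives Π_λ the rotated form in which U_λ can be pulled out to the left.
      rw [twUD, pair_dualExt, ← neg_neg ξ, ← twU_twPi, twUadj_twU, neg_neg]
    simpa only [e] using hF.rotate hp

/-! ### Gaussian form of the twisted Bargmann transform -/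

/-- The Gaussian with linear term `v`. -/
def gaussian {n : ℕ} (c : ℝ) (v : CC n) (x : RR n) : ℂ :=
  Complex.exp (-((c / 2 : ℝ) : ℂ) * cdot (toCC x) (toCC x) + cdot v (toCC x))

theorem gaussian_comp_toLp {n : ℕ} (c : ℝ) (v : CC n) :
    (gaussian c v ∘ WithLp.toLp 2) = fun x : Fin n ⊕ Fin n → ℝ =>
      Complex.exp (-((c / 2 : ℝ) : ℂ) * ∑ j, (x j : ℂ) ^ 2 + ∑ j, v j * x j) := by
  ext x
  simp [gaussian, cdot, toCC, sq]

theorem integrable_gaussian {n : ℕ} {c : ℝ} (hc : 0 < c) (v : CC n) :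
    Integrable (gaussian c v) := by
  rw [← (PiLp.volume_preserving_toLp (Fin n ⊕ Fin n)).integrable_comp_emb
    (MeasurableEquiv.toLp 2 _).measurableEmbedding, gaussian_comp_toLp]
  exact GaussianFourier.integrable_cexp_neg_mul_sum_add (by simpa using hc) _

theorem integral_gaussian {n : ℕ} {c : ℝ} (hc : 0 < c) (v : CC n) :
    ∫ x, gaussian c v x
      = ((2 * Real.pi / c : ℝ) : ℂ) ^ n * Complex.exp (cdot v v / (2 * c)) := by
  rw [← (PiLp.volume_preserving_toLp (Fin n ⊕ Fin n)).integral_comp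
    (MeasurableEquiv.toLp 2 _).measurableEmbedding]
  have h := GaussianFourier.integral_cexp_neg_mul_sum_add (b := ((c / 2 : ℝ) : ℂ))
    (by simpa using hc) (fun j => v j)
  have h' := congrFun (gaussian_comp_toLp c v)
  simp only [Function.comp_apply] at h'
  simp only [h', h, cdot]
  have hc' : (c : ℂ) ≠ 0 := by exact_mod_cast hc.ne'
  congr 1
  -- The dimension is 2n, so the complex power with exponent dim/2 is an ordinary n-th power.
  · rw [Fintype.card_sum, Fintype.card_fin, show (((n + n : ℕ) : ℂ) / 2) = (n : ℂ) by
      push_cast; ring, Complex.cpow_natCast]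
    congr 1
    push_cast
    field_simp
  · congr 2
    · exact Finset.sum_congr rfl fun j _ => sq _
    · push_cast
      ring

/-- The multiplication formula moves the transform onto the Gaussian. Its width c(λ) is the
self-dual one for the kernel exp(-i c(λ) x·y), so the transform is again such a Gaussian, with
linear term -iv. -/
theorem integral_twU_mul_gaussian {n : ℕ} {lam : ℝ} (hlam : lam ≠ 0) (g : 𝓢(RR n, ℂ)) (v : CC n) :
    ∫ x, twU lam hlam g x * gaussian (cFun lam) v x
      = Complex.exp (cdot v v / (2 * cFun lam)) *
        ∫ y, g y * gaussian (cFun lam) (-(Complex.I • v)) y := by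
  have hc := cFun_pos hlam
  have hc' : (cFun lam : ℂ) ≠ 0 := by exact_mod_cast hc.ne'
  set r : ℝ := cFun lam / (2 * Real.pi) with hr
  have hC : (cFun lam ^ n * ((2 * Real.pi) ^ n)⁻¹ : ℝ) = r ^ n := by
    rw [hr, div_pow, div_eq_mul_inv]
  let L : RR n →ₗ[ℝ] RR n →ₗ[ℝ] ℝ := r • innerₗ (RR n)
  have hL : Continuous fun p : RR n × RR n => L p.1 p.2 := by
    change Continuous fun p : RR n × RR n => r * inner ℝ p.1 p.2
    fun_prop
  have main := VectorFourier.integral_bilin_fourierIntegral_eq_flip (μ := volume) (ν := volume)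
    (ContinuousLinearMap.mul ℂ ℂ) Real.continuous_fourierChar hL g.integrable
    (integrable_gaussian hc v)
  have e1 : ∀ x, twU lam hlam g x = ((r ^ n : ℝ) : ℂ) *
      VectorFourier.fourierIntegral Real.fourierChar volume L g x := by
    intro x
    have e : twU lam hlam g x = (((cFun lam ^ n * ((2 * Real.pi) ^ n)⁻¹ : ℝ) : ℂ)) *
      𝓕 (g : RR n → ℂ) (r • x) := rfl
    rw [e, hC, Real.fourier_eq, VectorFourier.fourierIntegral]
    congr 1
    refine integral_congr_ae (Filter.Eventually.of_forall fun y => ?_)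
    simp only [inner_smul_right]
    rfl
  have e2 : ∀ y, ((r ^ n : ℝ) : ℂ) * VectorFourier.fourierIntegral Real.fourierChar volume L.flip
      (gaussian (cFun lam) v) y = Complex.exp (cdot v v / (2 * cFun lam)) *
        gaussian (cFun lam) (-(Complex.I • v)) y := by
    intro y
    -- The Fourier phase is absorbed into a complex linear term, so `integral_gaussian` evaluates
    -- the transform.
    have hv : VectorFourier.fourierIntegral Real.fourierChar volume L.flip
        (gaussian (cFun lam) v) y
        = ∫ x, gaussian (cFun lam) (v - (Complex.I * cFun lam) • toCC y) x := by
      rw [VectorFourier.fourierIntegral]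
      refine integral_congr_ae (Filter.Eventually.of_forall fun x => ?_)
      have hy : L.flip x y = r * inner ℝ y x := rfl
      simp only [hy, Circle.smul_def, smul_eq_mul, Real.fourierChar_apply, gaussian,
        ← Complex.exp_add]
      congr 1
      have hi : ((inner ℝ y x : ℝ) : ℂ) = cdot (toCC y) (toCC x) := by
        simp [PiLp.inner_apply, cdot, toCC, mul_comm]
      have hs : cdot (v - (Complex.I * cFun lam) • toCC y) (toCC x)
          = cdot v (toCC x) - Complex.I * cFun lam * cdot (toCC y) (toCC x) := by
        simp only [cdot, Finset.mul_sum, ← Finset.sum_sub_distrib, PiLp.sub_apply,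
          PiLp.smul_apply, smul_eq_mul]
        exact Finset.sum_congr rfl fun j _ => by ring
      rw [hs, hr]
      push_cast
      rw [hi]
      have : (Real.pi : ℂ) ≠ 0 := by exact_mod_cast Real.pi_ne_zero
      field_simp
      ring
    rw [hv, integral_gaussian hc, ← mul_assoc, Complex.ofReal_pow, ← mul_pow, ← Complex.ofReal_mul,
      hr, div_mul_div_cancel₀ (by positivity), div_self hc.ne', Complex.ofReal_one, one_pow,
      one_mul, gaussian, ← Complex.exp_add]
    congr 1
    have hs : cdot (v - (Complex.I * cFun lam) • toCC y) (v - (Complex.I * cFun lam) • toCC y)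
        = cdot v v - (2 * Complex.I * cFun lam) * cdot v (toCC y)
          - (cFun lam : ℂ) ^ 2 * cdot (toCC y) (toCC y) := by
      simp only [cdot, Finset.mul_sum, ← Finset.sum_sub_distrib, PiLp.sub_apply,
        PiLp.smul_apply, smul_eq_mul]
      refine Finset.sum_congr rfl fun j _ => ?_
      linear_combination ((cFun lam : ℂ) ^ 2 * toCC y j * toCC y j) * Complex.I_sq
    have hs' : cdot (-(Complex.I • v)) (toCC y) = -(Complex.I * cdot v (toCC y)) := by
      simp only [cdot, Finset.mul_sum, ← Finset.sum_neg_distrib, PiLp.neg_apply,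
        PiLp.smul_apply, smul_eq_mul]
      exact Finset.sum_congr rfl fun j _ => by ring
    rw [hs, hs']
    push_cast
    field_simp
    ring
  simp only [e1]
  simp only [ContinuousLinearMap.mul_apply'] at main
  simp only [mul_assoc, integral_const_mul, main]
  rw [← integral_const_mul, ← integral_const_mul]
  refine integral_congr_ae (Filter.Eventually.of_forall fun y => ?_)
  simp only
  rw [mul_left_comm, e2]
  ring

/-- After x = y + a, the translation contributes -ca and the modulation ib to the linear term; the
rest is constant in y. -/
theorem integral_isWeyl_mul_gaussian {n : ℕ} (c : ℝ) (v : CC n) {a b : RR n} {g h : RR n → ℂ}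
    (hgh : IsWeyl a b g h) :
    ∫ x, h x * gaussian c v x
      = Complex.exp (Complex.I / 2 * cdot (toCC a) (toCC b) - ((c / 2 : ℝ) : ℂ) *
          cdot (toCC a) (toCC a) + cdot v (toCC a)) *
        ∫ y, g y * gaussian c (v - ((c : ℂ) • toCC a - Complex.I • toCC b)) y := by
  rw [← integral_add_right_eq_self _ a, ← integral_const_mul]
  refine integral_congr_ae (Filter.Eventually.of_forall fun y => ?_)
  simp only [hgh (y + a), add_sub_cancel_right, gaussian, phase]
  rw [mul_right_comm, ← Complex.exp_add, mul_left_comm, ← Complex.exp_add, mul_comm]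
  congr 2
  simp only [PiLp.inner_apply, cdot, toCC, PiLp.add_apply, PiLp.sub_apply, PiLp.smul_apply,
    smul_eq_mul, RCLike.inner_apply, conj_trivial]
  push_cast
  simp only [Finset.sum_div, Finset.mul_sum, ← Finset.sum_sub_distrib,
    ← Finset.sum_add_distrib]
  refine Finset.sum_congr rfl fun j _ => ?_
  ring

/-- The linear term of the Gaussian kernel of the twisted Bargmann transform:
`c(λ) ζ - i(λ/2) J ζ`. -/
def bargmannVec {n : ℕ} (lam : ℝ) (ζ : CC n) : CC n :=
  WithLp.toLp 2 (Sum.elim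
    (fun i => cFun lam * ζ (Sum.inl i) - Complex.I * (lam / 2 : ℝ) * ζ (Sum.inr i))
    (fun i => cFun lam * ζ (Sum.inr i) + Complex.I * (lam / 2 : ℝ) * ζ (Sum.inl i)))

/-- The cross term of (ζ - x)·(ζ - x) and the symplectic twist are both linear in x; together they
form `bargmannVec`. -/
theorem heatKernel_mul_cexp {n : ℕ} (lam : ℝ) (ζ : CC n) (x : RR n) :
    heatKernel lam (1 / 2) (ζ - toCC x) *
      Complex.exp (-(Complex.I * (lam / 2 : ℝ)) * csymp ζ (toCC x))
      = heatKernel lam (1 / 2) ζ * gaussian (cFun lam) (bargmannVec lam ζ) x := by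
  rw [heatKernel, heatKernel, gaussian, mul_assoc (Complex.ofReal _),
    mul_assoc (Complex.ofReal _), ← Complex.exp_add, ← Complex.exp_add, one_div_mul_eq_div]
  congr 2
  simp only [cdot, csymp, toCC, bargmannVec, Fintype.sum_sum_type, PiLp.sub_apply, cFun,
    Finset.mul_sum, ← Finset.sum_add_distrib, Sum.elim_inl, Sum.elim_inr]
  refine Finset.sum_congr rfl fun i _ => ?_
  push_cast
  ring

/-- The exponent `(λ/8)(tanh(λ/2) - coth(λ/2))` in the Gaussian form of `B_λ`. -/
def bargmannExp (lam : ℝ) : ℝ := lam / 8 * (Real.tanh (lam / 2) - coth (lam / 2))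

/-- The constant is left unspecified, since it occurs identically on both sides of each intertwining
relation. -/
theorem exists_bargmann_eq (n : ℕ) {lam : ℝ} (hlam : lam ≠ 0) :
    ∃ D : ℂ, ∀ (g : RR n → ℂ) (ζ : CC n), bargmann lam g ζ
      = D * Complex.exp (bargmannExp lam * cdot ζ ζ) *
        ∫ x, g x * gaussian (cFun lam) (bargmannVec lam ζ) x := by
  refine ⟨(cConst n lam : ℂ) *
      ((((4 * Real.pi) ^ n)⁻¹ * lam ^ n * (Real.sinh (1 * lam) ^ n)⁻¹ : ℝ) : ℂ)⁻¹ *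
      ((((4 * Real.pi) ^ n)⁻¹ * lam ^ n * (Real.sinh (1 / 2 * lam) ^ n)⁻¹ : ℝ) : ℂ),
    fun g ζ => ?_⟩
  have e : ∀ x, g x * heatKernel lam (1 / 2) (ζ - toCC x) *
      Complex.exp (-(Complex.I * (lam / 2 : ℝ)) * csymp ζ (toCC x))
      = heatKernel lam (1 / 2) ζ * (g x * gaussian (cFun lam) (bargmannVec lam ζ) x) := by
    intro x
    rw [mul_assoc, heatKernel_mul_cexp, mul_left_comm]
  rw [bargmann]
  simp only [e]
  rw [integral_const_mul, ← mul_assoc]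
  congr 1
  have hE : Complex.exp (bargmannExp lam * cdot ζ ζ)
      = (Complex.exp (-((lam / 4 * coth (1 * lam) : ℝ) : ℂ) * cdot ζ ζ))⁻¹ *
        Complex.exp (-((lam / 4 * coth (1 / 2 * lam) : ℝ) : ℂ) * cdot ζ ζ) := by
    rw [← Complex.exp_neg, ← Complex.exp_add, one_mul, one_div_mul_eq_div, coth_eq_half hlam,
      bargmannExp]
    congr 1
    push_cast
    ring
  rw [hE, heatKernel, heatKernel, mul_inv]
  ring

theorem cdot_neg_I_smul {n : ℕ} (ζ : CC n) :
    cdot (-(Complex.I • ζ)) (-(Complex.I • ζ)) = -cdot ζ ζ := by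
  simp only [cdot, ← Finset.sum_neg_distrib, PiLp.neg_apply, PiLp.smul_apply, smul_eq_mul]
  exact Finset.sum_congr rfl fun j _ => by linear_combination ζ j * ζ j * Complex.I_sq

theorem bargmannVec_neg_I_smul {n : ℕ} (lam : ℝ) (ζ : CC n) :
    bargmannVec lam (-(Complex.I • ζ)) = -(Complex.I • bargmannVec lam ζ) := by
  ext j
  cases j <;> simp [bargmannVec] <;> ring

/-- As Jζ·ζ = 0, the square of cζ - i(λ/2)Jζ is (c² - λ²/4) ζ·ζ. The factor -2 is what
`bargmann_twU` needs: it turns κ into -κ, matching (-iζ)·(-iζ) = -ζ·ζ. -/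
theorem cdot_bargmannVec {n : ℕ} {lam : ℝ} (hlam : lam ≠ 0) (ζ : CC n) :
    cdot (bargmannVec lam ζ) (bargmannVec lam ζ) / (2 * cFun lam)
      = -(2 * bargmannExp lam) * cdot ζ ζ := by
  have hc : (cFun lam : ℂ) ≠ 0 := by exact_mod_cast (cFun_pos hlam).ne'
  have hT : (lam : ℂ) / 2 = cFun lam * Real.tanh (lam / 2) := by exact_mod_cast lam_eq hlam
  have hK : (cFun lam : ℂ) = lam / 2 * coth (lam / 2) := by
    rw [cFun]
    push_cast
    rfl
  have hs : cdot (bargmannVec lam ζ) (bargmannVec lam ζ)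
      = ((cFun lam : ℂ) ^ 2 - (lam / 2) ^ 2) * cdot ζ ζ := by
    simp only [cdot, bargmannVec, Fintype.sum_sum_type, Finset.mul_sum, ← Finset.sum_add_distrib,
      Sum.elim_inl, Sum.elim_inr]
    refine Finset.sum_congr rfl fun i _ => ?_
    push_cast
    linear_combination (lam / 2) ^ 2 * (ζ (Sum.inl i) ^ 2 + ζ (Sum.inr i) ^ 2) * Complex.I_sq
  rw [hs, div_eq_iff (by simpa using hc), bargmannExp]
  push_cast
  push_cast at hT
  linear_combination (cdot ζ ζ * cFun lam) * hK - (cdot ζ ζ * lam / 2) * hT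

theorem bargmann_twU {n : ℕ} {lam : ℝ} (hlam : lam ≠ 0) (g : 𝓢(RR n, ℂ)) (ζ : CC n) :
    bargmann lam (twU lam hlam g) ζ = bargmann lam g (-(Complex.I • ζ)) := by
  obtain ⟨D, hD⟩ := exists_bargmann_eq n hlam
  rw [hD, hD, integral_twU_mul_gaussian, bargmannVec_neg_I_smul, cdot_bargmannVec hlam,
    cdot_neg_I_smul, ← mul_assoc, mul_assoc D, ← Complex.exp_add]
  congr 3
  ring

/-! ### The twisted Bargmann transform intertwines `Π_λ` and `ρ_λ` -/

/-- By linearity this says v(ξ+iη) = ca - ib, so the change that Π_λ(ξ,η) makes in the linear term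
is the translation ζ ↦ ζ - (ξ+iη). -/
theorem bargmannVec_sub {n : ℕ} {lam : ℝ} (hlam : lam ≠ 0) (ξ η : RR n) (ζ : CC n) :
    bargmannVec lam (ζ - (toCC ξ + Complex.I • toCC η)) = bargmannVec lam ζ -
      ((cFun lam : ℂ) • toCC (weylShift lam ξ η) - Complex.I • toCC (weylFreq lam ξ η)) := by
  have hT : (lam : ℂ) / 2 = cFun lam * Real.tanh (lam / 2) := by exact_mod_cast lam_eq hlam
  push_cast at hT
  ext j
  cases j with
  | inl i =>
    simp [bargmannVec, toCC, weylShift, weylFreq, rotJ]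
    linear_combination (-η (Sum.inr i) : ℂ) * hT + (lam / 2 * η (Sum.inr i) : ℂ) * Complex.I_sq
  | inr i =>
    simp [bargmannVec, toCC, weylShift, weylFreq, rotJ]
    linear_combination (η (Sum.inl i) : ℂ) * hT - (lam / 2 * η (Sum.inl i) : ℂ) * Complex.I_sq

theorem bargmann_exponent {n : ℕ} {lam : ℝ} (hlam : lam ≠ 0) (ξ η : RR n) (ζ : CC n) :
    bargmannExp lam * cdot ζ ζ + (Complex.I / 2 * cdot (toCC (weylShift lam ξ η))
        (toCC (weylFreq lam ξ η)) - ((cFun lam / 2 : ℝ) : ℂ) *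
      cdot (toCC (weylShift lam ξ η)) (toCC (weylShift lam ξ η)) +
        cdot (bargmannVec lam ζ) (toCC (weylShift lam ξ η)))
    = bargmannExp lam * cdot (ζ - (toCC ξ + Complex.I • toCC η))
        (ζ - (toCC ξ + Complex.I • toCC η)) +
      (lam / 2 * coth lam : ℝ) * cdot ζ (conjCC (toCC ξ + Complex.I • toCC η)) +
      -(Complex.I * (lam / 2 : ℝ)) * csymp ζ (conjCC (toCC ξ + Complex.I • toCC η)) +
      ((-(lam / 4 * coth lam * ‖toCC ξ + Complex.I • toCC η‖ ^ 2) : ℝ) : ℂ) +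
      ((lam / 2 * symp (reCC (toCC ξ + Complex.I • toCC η))
        (imCC (toCC ξ + Complex.I • toCC η)) : ℝ) : ℂ) := by
  have h := tanh_mul_coth (s := lam / 2) (by positivity)
  rw [EuclideanSpace.norm_sq_eq, coth_eq_half hlam, bargmannExp, cFun]
  simp only [bargmannVec, weylShift, weylFreq, cFun]
  -- Only tanh · coth = 1 is used from here on: the claim becomes a polynomial identity modulo TK =
  -- 1 and i² = -1, checked on each pair of coordinates (xᵢ, uᵢ).
  generalize Real.tanh (lam / 2) = T at *
  generalize coth (lam / 2) = K at *
  have hTK : (T : ℂ) * K = 1 := by exact_mod_cast h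
  simp only [← Complex.normSq_eq_norm_sq, cdot, csymp, symp, Fintype.sum_sum_type, conjCC, reCC,
    imCC, toCC, rotJ, PiLp.add_apply, PiLp.sub_apply, PiLp.smul_apply,
    smul_eq_mul, Sum.elim_inl, Sum.elim_inr, Complex.normSq_apply, Complex.add_re, Complex.add_im,
    Complex.mul_re, Complex.mul_im, Complex.I_re, Complex.I_im, Complex.ofReal_re,
    Complex.ofReal_im, map_add, map_mul, Complex.conj_I, Complex.conj_ofReal]
  push_cast
  simp only [neg_mul, Finset.mul_sum, ← Finset.sum_neg_distrib, ← Finset.sum_add_distrib,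
    ← Finset.sum_sub_distrib]
  refine Finset.sum_congr rfl fun i _ => ?_
  linear_combination
    (lam / 2 * (ζ (Sum.inl i) * η (Sum.inr i) - ζ (Sum.inr i) * η (Sum.inl i)) - lam / 4 *
      (2 * ξ (Sum.inl i) * η (Sum.inr i) - 2 * ξ (Sum.inr i) * η (Sum.inl i)
        + T * (η (Sum.inl i) ^ 2 + η (Sum.inr i) ^ 2)) : ℂ) * hTK
    - (lam / 8 * (T - K) * (η (Sum.inl i) ^ 2 + η (Sum.inr i) ^ 2) + lam / 2 *
      (ζ (Sum.inr i) * η (Sum.inl i) - ζ (Sum.inl i) * η (Sum.inr i)) : ℂ) * Complex.I_sq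

theorem bargmann_twPi {n : ℕ} {lam : ℝ} (hlam : lam ≠ 0) (ξ η : RR n) (g : 𝓢(RR n, ℂ)) :
    bargmann lam (twPi lam ξ η g)
      = fockRep lam (toCC ξ + Complex.I • toCC η) (bargmann lam g) := by
  obtain ⟨D, hD⟩ := exists_bargmann_eq n hlam
  ext ζ
  rw [fockRep, hD, hD, integral_isWeyl_mul_gaussian _ _ (twPi_isWeyl hlam ξ η g),
    ← bargmannVec_sub hlam, ← mul_assoc, mul_assoc D, ← Complex.exp_add, bargmann_exponent hlam,
    Complex.exp_add, Complex.exp_add, Complex.exp_add, Complex.exp_add]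
  ring

end TwistedMod

end

theorem mainTheorem6 (n : ℕ) (lam : ℝ) (hlam : lam ≠ 0) :
    ((∀ (ξ η : TwistedMod.RR n) (g : 𝓢(TwistedMod.RR n, ℂ)),
        TwistedMod.bargmann lam (TwistedMod.twPi lam ξ η g)
          = TwistedMod.fockRep lam (TwistedMod.toCC ξ + Complex.I • TwistedMod.toCC η)
              (TwistedMod.bargmann lam g)) ∧
      (∀ (g : 𝓢(TwistedMod.RR n, ℂ)) (ζ : TwistedMod.CC n),
        TwistedMod.bargmann lam (TwistedMod.twU lam hlam g) ζ
          = TwistedMod.bargmann lam g (-(Complex.I • ζ)))) ∧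
    (∀ (p q : ℝ≥0∞), 1 ≤ p → 1 ≤ q → ∀ f ∈ TwistedMod.modSpace n lam p q,
      (∀ ξ : TwistedMod.RR n, TwistedMod.twTransD lam ξ f ∈ TwistedMod.modSpace n lam p q) ∧
      (∀ η : TwistedMod.RR n, TwistedMod.twModD lam η f ∈ TwistedMod.modSpace n lam p q)) ∧
    (∀ (ξ η : TwistedMod.RR n) (f : 𝓢'(TwistedMod.RR n, ℂ)),
      TwistedMod.twUD lam hlam (TwistedMod.twPiD lam ξ η (TwistedMod.twUadjD lam hlam f))
        = TwistedMod.twPiD lam (-η) ξ f) ∧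
    (∀ p : ℝ≥0∞, 1 ≤ p → ∀ f ∈ TwistedMod.modSpace n lam p p,
      TwistedMod.twUD lam hlam f ∈ TwistedMod.modSpace n lam p p) := by
  refine ⟨⟨TwistedMod.bargmann_twPi hlam, TwistedMod.bargmann_twU hlam⟩,
    fun p q _ _ f hf => ⟨fun ξ => ?_, fun η => ?_⟩, TwistedMod.twUD_twPiD_twUadjD hlam,
    fun p hp f hf => TwistedMod.twUD_mem_modSpace hlam hp hf⟩
  · rw [TwistedMod.twTransD, ← TwistedMod.twPi_zero_right]
    exact TwistedMod.dualExt_twPi_mem_modSpace hlam hf _ _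
  · rw [TwistedMod.twModD, ← TwistedMod.twPi_zero_left]
    exact TwistedMod.dualExt_twPi_mem_modSpace hlam hf _ _
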